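/- Let $X$ be a nonempty compact metric space with distance $d$ and $T\colon X\to X$ a homeomorphism such that $(X,T)$ is minimal (every orbit $\{T^nx : n\in\mathbb Z\}$ is dense in $X$) and distal ($\inf_{n\in\mathbb Z} d(T^nx,T^ny)>0$ for all $x\ne y$ in $X$). Let $\mathcal P\subset X^4$ be the closure of $$\{(x,T^mx,T^nx,T^{m+n}x) : x\in X,\ m,n\in\mathbb Z\}$$ and let $\mathcal Q\subset X^8$ be the closure of $$\{(x,T^mx,T^nx,T^{m+n}x,T^px,T^{m+p}x,T^{n+p}x,T^{m+n+p}x) : x\in X,\ m,n,p\in\mathbb Z\}.$$ Number the vertices of the cube $\{0,1\}^3$ from $0$ to $7$ by binary expansion, and identify $X^8$ with $X^4\times X^4$. Then the closed sets $(\mathcal P,\mathcal Q)$ form a parallelepiped structure on $X$ in the sense of Host and Kra, that is: 1. (Parallelogram structure.) The relation $(x_0,x_1)\sim(x_2,x_3)\iff(x_0,x_1,x_2,x_3)\in\mathcal P$ is an equivalence relation on $X^2$; if $(x_0,x_1,x_2,x_3)\in\mathcal P$ then $(x_0,x_2,x_1,x_3)\in\mathcal P$; and for all $x_0,x_1,x_2\in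 X$ there is $x_3\in X$ with $(x_0,x_1,x_2,x_3)\in\mathcal P$. 2. (Faces.) If $(x_0,\dots,x_7)\in\mathcal Q$, then each of its six faces $(x_0,x_1,x_2,x_3)$, $(x_4,x_5,x_6,x_7)$, $(x_0,x_1,x_4,x_5)$, $(x_2,x_3,x_6,x_7)$, $(x_0,x_2,x_4,x_6)$, $(x_1,x_3,x_5,x_7)$ belongs to $\mathcal P$. 3. (Symmetry.) $\mathcal Q$ is invariant under the permutations of coordinates induced by the Euclidean isometries of the cube. 4. (Equivalence relation.) The relation $\mathbf u\approx\mathbf v\iff(\mathbf u,\mathbf v)\in\mathcal Q$ is an equivalence relation on $\mathcal P$; in particular $\mathcal Q$ is transitive: if $\mathbf u,\mathbf v,\mathbf w\in\mathcal P$ and $(\mathbf u,\mathbf v),(\mathbf v,\mathbf w)\in\mathcal Q$, then $(\mathbf u,\mathbf w)\in\mathcal Q$. 5. (Closing property.) If $(x_0,x_1,x_2,x_3)$, $(x_0,x_1,x_4,x_5)$ and $(x_0,x_2,x_4,x_6)$ belong to $\mathcal P$, then there is $x_7\in X$ with $(x_0,\dots,x_7)\in\mathcal Q$. Moreover, for every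 $(x_0,\dots,x_6)\in X^7$ the following are equivalent: (a) $(x_0,x_1,x_2,x_3)$, $(x_0,x_1,x_4,x_5)$ and $(x_0,x_2,x_4,x_6)$ belong to $\mathcal P$; (b) there is $x_7\in X$ with $(x_0,\dots,x_6,x_7)\in\mathcal Q$; (c) there are sequences of integers $(m_i)$, $(n_i)$, $(p_i)$ with $T^{m_i}x_0\to x_1$, $T^{n_i}x_0\to x_2$, $T^{m_i+n_i}x_0\to x_3$, $T^{p_i}x_0\to x_4$, $T^{m_i+p_i}x_0\to x_5$ and $T^{n_i+p_i}x_0\to x_6$. -/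

import Mathlib

open Filter Topology

namespace DynPara

/-- The system `(X, T)` is minimal: every orbit `{T ^ n x : n ∈ ℤ}` is dense. -/
def IsMinimal {X : Type*} [TopologicalSpace X] (T : X ≃ₜ X) : Prop :=
  ∀ x : X, Dense (Set.range fun n : ℤ => (T ^ n) x)

/-- The system `(X, T)` is distal: `inf_{n ∈ ℤ} d(T ^ n x, T ^ n y) > 0` whenever `x ≠ y`. -/
def IsDistal {X : Type*} [MetricSpace X] (T : X ≃ₜ X) : Prop :=
  ∀ x y : X, x ≠ y → 0 < ⨅ n : ℤ, dist ((T ^ n) x) ((T ^ n) y)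

/-- The set of dynamical parallelograms, a subset of `X ^ 4`. -/
def parallelograms {X : Type*} [TopologicalSpace X] (T : X ≃ₜ X) : Set (Fin 4 → X) :=
  closure {y | ∃ (x : X) (m n : ℤ), y = ![x, (T ^ m) x, (T ^ n) x, (T ^ (m + n)) x]}

/-- The set of dynamical parallelepipeds, a subset of `X ^ 8`. -/
def parallelepipeds {X : Type*} [TopologicalSpace X] (T : X ≃ₜ X) : Set (Fin 8 → X) :=
  closure {y | ∃ (x : X) (m n p : ℤ),
    y = ![x, (T ^ m) x, (T ^ n) x, (T ^ (m + n)) x,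
      (T ^ p) x, (T ^ (m + p)) x, (T ^ (n + p)) x, (T ^ (m + n + p)) x]}

/-- The identification of `X ^ 4 × X ^ 4` with `X ^ 8`. -/
def pair {X : Type*} (u v : Fin 4 → X) : Fin 8 → X :=
  ![u 0, u 1, u 2, u 3, v 0, v 1, v 2, v 3]

/-- The vertices of the cube `{0,1} ^ 3` are numbered `0, …, 7` by their binary expansions;
this is the vertex of `{0,1} ^ 3` with number `i`. -/
def vertex (i : Fin 8) : Fin 3 → Bool :=
  fun k => (i : ℕ).testBit k

/-- The six two-dimensional faces of the cube, each as the increasing list of its vertices. -/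
def face : Fin 6 → Fin 4 → Fin 8 :=
  ![![0, 1, 2, 3], ![4, 5, 6, 7], ![0, 1, 4, 5], ![2, 3, 6, 7], ![0, 2, 4, 6], ![1, 3, 5, 7]]

/-- Euclidean permutations of the cube: the permutations of its vertices that are isometries.
The squared Euclidean distance of two vertices is their Hamming distance. -/
def IsEuclidean (σ : Equiv.Perm (Fin 8)) : Prop :=
  ∀ i j : Fin 8,
    hammingDist (vertex (σ i)) (vertex (σ j)) = hammingDist (vertex i) (vertex j)

/-- (Weak) parallelogram structures on `X` in the sense of Host and Kra. -/
structure IsParallelogramStructure {X : Type*} (P : Set (Fin 4 → X)) : Prop where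
  /-- The relation `(x₀, x₁) ∼ (x₂, x₃)` on `X ^ 2`. -/
  equivalence : Equivalence fun a b : X × X => ![a.1, a.2, b.1, b.2] ∈ P
  symmetry : ∀ x₀ x₁ x₂ x₃ : X, ![x₀, x₁, x₂, x₃] ∈ P → ![x₀, x₂, x₁, x₃] ∈ P
  closing : ∀ x₀ x₁ x₂ : X, ∃ x₃ : X, ![x₀, x₁, x₂, x₃] ∈ P

/-- (Weak) parallelepiped structures on `X` in the sense of Host and Kra. -/
structure IsParallelepipedStructure {X : Type*} (P : Set (Fin 4 → X)) (Q : Set (Fin 8 → X)) :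
    Prop where
  parallelogram : IsParallelogramStructure P
  face_mem : ∀ x ∈ Q, ∀ f : Fin 6, x ∘ face f ∈ P
  symmetry : ∀ x ∈ Q, ∀ σ : Equiv.Perm (Fin 8), IsEuclidean σ → x ∘ σ ∈ Q
  /-- The relation `u ≈ v` on `P`. -/
  equivalence : Equivalence fun u v : P => pair (u : Fin 4 → X) (v : Fin 4 → X) ∈ Q
  closing : ∀ x₀ x₁ x₂ x₃ x₄ x₅ x₆ : X,
    ![x₀, x₁, x₂, x₃] ∈ P → ![x₀, x₁, x₄, x₅] ∈ P → ![x₀, x₂, x₄, x₆] ∈ P →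
      ∃ x₇ : X, ![x₀, x₁, x₂, x₃, x₄, x₅, x₆, x₇] ∈ Q

end DynPara

/-!
Two facts drive the proof. In a distal system the Ellis semigroup is a group, so lying in the
orbit closure of a point is an equivalence relation; this applies to every group of exponents acting
coordinatewise on a power of `X`. By minimality, parallelograms and parallelepipeds are exactly the
points that can be approached from a constant point. A pair `(u, v)` is moved back to a constant
point while `u` is also carried along with a third configuration, which gives transitivity.

The main difficulty is to approach a parallelogram `(x, x₁, x₂, x₃)` from `(x, x, x, x)` by
exponents `(0, m, n, m + n)`, that is, with the base point fixed. Moving `x₁` and `x₂` to `x`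
reduces this to `(x, x, x, y)`. Call `a` and `b` related if `(x, a, x, b)` can be approached in this
way. If `x` and `y` were not related, a continuous function `h` compatible with this closed relation
would separate them. For such an `h` the limit of `g +ᵥ x` determines that of `h (g +ᵥ a)`, and
Baire's theorem makes the translates of `h` equicontinuous. But then `h` takes the same value at the
last two vertices of a parallelogram whose first two vertices coincide.

For the closing property, three parallelograms with common base point `x` are moved to the constant
point one at a time, each time carrying the remaining vertices along; the exponents of the seven
vertices then also determine a limit for the eighth.
-/

namespace DynPara

section Reach

variable {G H Y Z W : Type*} [TopologicalSpace Y] [TopologicalSpace Z]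

/-- `y` belongs to the orbit closure of `x`, that is, `y` can be approached from `x` by the action
of `G`. -/
def Reach (G : Type*) [VAdd G Y] (x y : Y) : Prop :=
  y ∈ closure (Set.range fun g : G => g +ᵥ x)

theorem isClosed_setOf_reach [VAdd G Y] (x : Y) : IsClosed {y | Reach G x y} :=
  isClosed_closure

theorem Reach.mem_of_isClosed [VAdd G Y] {x y : Y} (h : Reach G x y) {s : Set Y}
    (hs : IsClosed s) (hx : ∀ g : G, g +ᵥ x ∈ s) : y ∈ s :=
  closure_minimal (Set.range_subset_iff.2 hx) hs h

theorem reach_vadd [VAdd G Y] (g : G) (x : Y) : Reach G x (g +ᵥ x) :=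
  subset_closure ⟨g, rfl⟩

theorem reach_of_isMinimal [AddMonoid G] [AddAction G Y] [AddAction.IsMinimal G Y] (x y : Y) :
    Reach G x y :=
  AddAction.dense_orbit G x y

section Preorder

variable [AddMonoid G] [AddAction G Y] {x y z : Y}

theorem Reach.refl (x : Y) : Reach G x x := by
  simpa only [zero_vadd] using reach_vadd (0 : G) x

theorem Reach.vadd_right [ContinuousConstVAdd G Y] (h : Reach G x y) (g : G) :
    Reach G x (g +ᵥ y) :=
  h.mem_of_isClosed ((isClosed_setOf_reach x).preimage (continuous_const_vadd g)) fun g' => by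
    simpa only [add_vadd] using! reach_vadd (g + g') x

theorem Reach.trans [ContinuousConstVAdd G Y] (hxy : Reach G x y) (hyz : Reach G y z) :
    Reach G x z :=
  hyz.mem_of_isClosed (isClosed_setOf_reach x) hxy.vadd_right

end Preorder

theorem exists_mem_closure_range_prodMk {ι : Type*} [TopologicalSpace W] [CompactSpace W]
    (f : ι → W) (g : ι → Z) {z : Z} (hz : z ∈ closure (Set.range g)) :
    ∃ w, (w, z) ∈ closure (Set.range fun i => (f i, g i)) := by
  have hclosed : IsClosed (Prod.snd '' closure (Set.range fun i => (f i, g i))) :=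
    isClosedMap_snd_of_compactSpace _ isClosed_closure
  have hrange : Set.range g ⊆ Prod.snd '' closure (Set.range fun i => (f i, g i)) :=
    Set.range_subset_iff.2 fun i => ⟨(f i, g i), subset_closure ⟨i, rfl⟩, rfl⟩
  obtain ⟨⟨w, _⟩, hw, rfl⟩ := closure_minimal hrange hclosed hz
  exact ⟨w, hw⟩

theorem reach_of_mem_closure_range {ι : Type*} [VAdd H Z] {f : ι → Y} {F : Y → Z} {y : Y} {z : Z}
    (hy : y ∈ closure (Set.range f)) (hF : Continuous F) (hf : ∀ i, ∃ a : H, a +ᵥ z = F (f i)) :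
    Reach H z (F y) :=
  map_mem_closure hF hy (by rintro _ ⟨i, rfl⟩; exact hf i)

theorem Reach.map [VAdd G Y] [VAdd H Z] {x y : Y} (h : Reach G x y) {F : Y → Z}
    (hF : Continuous F) (hmap : ∀ g : G, ∃ a : H, a +ᵥ F x = F (g +ᵥ x)) :
    Reach H (F x) (F y) :=
  reach_of_mem_closure_range h hF hmap

theorem Reach.exists_carry [VAdd G Z] [TopologicalSpace W] [CompactSpace W] {z z' : Z}
    (h : Reach G z z') (f : G → W) :
    ∃ w, (w, z') ∈ closure (Set.range fun g => (f g, g +ᵥ z)) :=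
  exists_mem_closure_range_prodMk f _ h

theorem Reach.exists_prod [VAdd G Y] [VAdd G Z] [CompactSpace Y] {z z' : Z} (h : Reach G z z')
    (y : Y) : ∃ y', Reach G (y, z) (y', z') :=
  h.exists_carry fun g => g +ᵥ y

end Reach

section Distal

/-- Distality in its topological form: distinct points are never proximal. -/
def IsDistalAction (G Y : Type*) [TopologicalSpace Y] [VAdd G Y] : Prop :=
  ∀ x y z : Y, Reach G (x, y) (z, z) → x = y

/-- The Ellis semigroup of an action: the closure, for pointwise convergence, of the
translations. -/
def ellisSemigroup (G Y : Type*) [TopologicalSpace Y] [VAdd G Y] : Set (Y → Y) :=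
  closure (Set.range fun (g : G) y => g +ᵥ y)

variable {G Y Z : Type*} [TopologicalSpace Y] [TopologicalSpace Z]

theorem reach_of_mem_ellisSemigroup [VAdd G Y] {p : Y → Y} (hp : p ∈ ellisSemigroup G Y) (y : Y) :
    Reach G y (p y) :=
  reach_of_mem_closure_range (F := fun q : Y → Y => q y) hp (continuous_apply y)
    fun g => ⟨g, rfl⟩

theorem Reach.exists_mem_ellisSemigroup [VAdd G Y] [CompactSpace Y] [T2Space Y] {x y : Y}
    (h : Reach G x y) : ∃ p ∈ ellisSemigroup G Y, p x = y :=
  h.mem_of_isClosed (s := (fun p : Y → Y => p x) '' ellisSemigroup G Y)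
    (isClosed_closure.isCompact.image (continuous_apply x)).isClosed
    fun g => ⟨_, subset_closure ⟨g, rfl⟩, rfl⟩

theorem comp_mem_ellisSemigroup [AddMonoid G] [AddAction G Y] [ContinuousConstVAdd G Y]
    {p q : Y → Y} (hp : p ∈ ellisSemigroup G Y) (hq : q ∈ ellisSemigroup G Y) :
    p ∘ q ∈ ellisSemigroup G Y := by
  have hvadd (g : G) : (fun y => g +ᵥ q y) ∈ ellisSemigroup G Y :=
    map_mem_closure (f := fun (q : Y → Y) y => g +ᵥ q y) (by fun_prop) hq (by
      rintro _ ⟨g', rfl⟩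
      exact ⟨g + g', funext fun y => add_vadd g g' y⟩)
  exact closure_minimal (s := Set.range fun (g : G) (y : Y) => g +ᵥ y)
    (t := (· ∘ q) ⁻¹' ellisSemigroup G Y) (Set.range_subset_iff.2 hvadd)
    (isClosed_closure.preimage (by fun_prop)) hp

theorem IsDistalAction.eq_id_of_comp_self [VAdd G Y] (hG : IsDistalAction G Y) {p : Y → Y}
    (hp : p ∈ ellisSemigroup G Y) (hpp : p ∘ p = p) : p = id := by
  funext y
  have h : Reach G (p y, y) (p (p y), p y) :=
    reach_of_mem_closure_range (F := fun q : Y → Y => (q (p y), q y)) hp (by fun_prop)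
      fun g => ⟨g, rfl⟩
  rw [show p (p y) = p y from congrFun hpp y] at h
  exact hG _ _ _ h

theorem exists_comp_self_eq_of_isCompact [T2Space Y] {s : Set (Y → Y)} (hs : s.Nonempty)
    (hcompact : IsCompact s) (hcomp : ∀ p ∈ s, ∀ q ∈ s, p ∘ q ∈ s) : ∃ p ∈ s, p ∘ p = p := by
  let : TopologicalSpace (Function.End Y) := inferInstanceAs (TopologicalSpace (Y → Y))
  have : T2Space (Function.End Y) := inferInstanceAs (T2Space (Y → Y))
  have hmul (r : Function.End Y) : Continuous (· * r) :=
    continuous_pi (A := fun _ : Y => Y) fun y => continuous_apply (A := fun _ : Y => Y) (r y)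
  exact exists_idempotent_in_compact_subsemigroup hmul s hs hcompact hcomp

theorem IsDistalAction.prod [VAdd G Y] [VAdd G Z] (hY : IsDistalAction G Y)
    (hZ : IsDistalAction G Z) : IsDistalAction G (Y × Z) := fun _ _ _ h =>
  Prod.ext
    (hY _ _ _ (h.map (F := fun p => (p.1.1, p.2.1)) (by fun_prop) fun g => ⟨g, rfl⟩))
    (hZ _ _ _ (h.map (F := fun p => (p.1.2, p.2.2)) (by fun_prop) fun g => ⟨g, rfl⟩))

variable [CompactSpace Y] [T2Space Y]

theorem IsDistalAction.exists_comp_eq_id [AddMonoid G] [AddAction G Y] [ContinuousConstVAdd G Y]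
    (hG : IsDistalAction G Y) {p : Y → Y} (hp : p ∈ ellisSemigroup G Y) :
    ∃ q ∈ ellisSemigroup G Y, q ∘ p = id := by
  obtain ⟨_, ⟨q, hq, rfl⟩, hqp⟩ := exists_comp_self_eq_of_isCompact
    (s := (· ∘ p) '' ellisSemigroup G Y) ⟨_, p, hp, rfl⟩
    (isClosed_closure.isCompact.image (by fun_prop)) (by
      rintro _ ⟨q, hq, rfl⟩ _ ⟨r, hr, rfl⟩
      exact ⟨q ∘ p ∘ r, comp_mem_ellisSemigroup hq (comp_mem_ellisSemigroup hp hr), rfl⟩)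
  exact ⟨q, hq, hG.eq_id_of_comp_self (comp_mem_ellisSemigroup hq hp) hqp⟩

/-- The Ellis semigroup of a distal action is a group. -/
theorem IsDistalAction.reach_symm [AddMonoid G] [AddAction G Y] [ContinuousConstVAdd G Y]
    (hG : IsDistalAction G Y) {x y : Y} (h : Reach G x y) : Reach G y x := by
  obtain ⟨p, hp, rfl⟩ := h.exists_mem_ellisSemigroup
  obtain ⟨q, hq, hqp⟩ := hG.exists_comp_eq_id hp
  simpa only [show q (p x) = x from congrFun hqp x] using reach_of_mem_ellisSemigroup hq (p x)

end Distal

section Separation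

theorem t2Space_of_isClosedMap {X Y : Type*} [TopologicalSpace X] [TopologicalSpace Y]
    [T1Space X] [NormalSpace X] {f : X → Y} (hf : IsClosedMap f) (hcont : Continuous f)
    (hsurj : Function.Surjective f) : T2Space Y := by
  have hfiber (y : Y) : IsClosed (f ⁻¹' {y}) := by
    obtain ⟨x, rfl⟩ := hsurj y
    simpa only [Set.image_singleton] using (hf _ (isClosed_singleton (x := x))).preimage hcont
  refine t2Space_iff_disjoint_nhds.2 fun y y' hne => (disjoint_comap_iff hsurj).1 ?_
  rw [hf.comap_nhds_eq hcont, hf.comap_nhds_eq hcont, ← separatedNhds_iff_disjoint]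
  exact normal_separation (hfiber y) (hfiber y')
    (Disjoint.preimage f (Set.disjoint_singleton.2 hne))

variable {X : Type*} [TopologicalSpace X] [CompactSpace X] (s : Setoid X)

theorem isClosedMap_quotientMk (hs : IsClosed {p : X × X | s p.1 p.2}) :
    IsClosedMap (Quotient.mk s) := fun C hC => by
  have hsat : Quotient.mk s ⁻¹' (Quotient.mk s '' C) =
      Prod.snd '' ({p : X × X | s p.1 p.2} ∩ Prod.fst ⁻¹' C) := by
    ext b
    simp [Quotient.eq, and_comm]
  rw [← isQuotientMap_quotient_mk'.isClosed_preimage]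
  change IsClosed (Quotient.mk s ⁻¹' _)
  rw [hsat]
  exact isClosedMap_snd_of_compactSpace _ (hs.inter (hC.preimage continuous_fst))

theorem exists_continuous_invariant_ne [T2Space X] (hs : IsClosed {p : X × X | s p.1 p.2}) {x y : X}
    (hxy : ¬ s x y) : ∃ h : C(X, ℝ), (∀ a b, s a b → h a = h b) ∧ h x ≠ h y := by
  have := t2Space_of_isClosedMap (isClosedMap_quotientMk s hs) continuous_quotient_mk'
    Quotient.mk_surjective
  obtain ⟨g, hg₀, hg₁, -⟩ := exists_continuous_zero_one_of_isClosed
    (isClosed_singleton (x := Quotient.mk s x)) (isClosed_singleton (x := Quotient.mk s y))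
    (Set.disjoint_singleton.2 fun h => hxy (Quotient.exact h))
  refine ⟨g.comp ⟨Quotient.mk s, continuous_quotient_mk'⟩,
    fun a b hab => congrArg g (Quotient.sound hab), ?_⟩
  change g (Quotient.mk s x) ≠ g (Quotient.mk s y)
  rw [hg₀ rfl, hg₁ rfl]
  exact zero_ne_one

end Separation

section CoordinateAction

variable {G X I J : Type*} [AddGroup G] [AddAction G X]

theorem vadd_apply {A : AddSubgroup (I → G)} (a : A) (u : I → X) (i : I) :
    (a +ᵥ u) i = a.1 i +ᵥ u i := rfl

theorem append_vadd_append {n m : ℕ} (a : Fin n → G) (b : Fin m → G) (u : Fin n → X)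
    (v : Fin m → X) : Fin.append a b +ᵥ Fin.append u v = Fin.append (a +ᵥ u) (b +ᵥ v) := by
  funext i
  cases i using Fin.addCases <;> simp

theorem append_vec_two {a b c d : X} : Fin.append ![a, b] ![c, d] = ![a, b, c, d] := by
  ext i
  fin_cases i <;> rfl

theorem append_const (n m : ℕ) (x : X) :
    Fin.append (fun _ : Fin n => x) (fun _ : Fin m => x) = fun _ => x := by
  ext i
  cases i using Fin.addCases <;> simp

variable [TopologicalSpace X] {A : AddSubgroup (I → G)} {B : AddSubgroup (J → G)}

theorem IsDistalAction.pi (hG : IsDistalAction G X) (A : AddSubgroup (I → G)) :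
    IsDistalAction A (I → X) := fun _ _ _ h => funext fun i =>
  hG _ _ _ (h.map (F := fun p => (p.1 i, p.2 i)) (by fun_prop) fun a => ⟨a.1 i, rfl⟩)

theorem Reach.comp {u v : I → X} (h : Reach A u v) (f : J → I) (hf : ∀ a ∈ A, a ∘ f ∈ B) :
    Reach B (u ∘ f) (v ∘ f) :=
  h.map (F := (· ∘ f)) (by fun_prop) fun a => ⟨⟨_, hf a a.2⟩, rfl⟩

variable [ContinuousConstVAdd G X]

instance : ContinuousConstVAdd (I → G) (I → X) where
  continuous_const_vadd a :=
    continuous_pi fun i => (continuous_apply i).const_vadd (a i)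

instance : ContinuousConstVAdd A (I → X) where
  continuous_const_vadd a := continuous_const_vadd (a : I → G)

theorem IsDistalAction.reach_append_trans [CompactSpace X] [T2Space X] (hG : IsDistalAction G X)
    {n : ℕ} {A : AddSubgroup (Fin (n + n) → G)}
    (hA : ∀ a b : Fin n → G, Fin.append a b ∈ A → Fin.append a a ∈ A) {p u v w : Fin n → X}
    (huv : Reach A (Fin.append p p) (Fin.append u v))
    (hvw : Reach A (Fin.append p p) (Fin.append v w)) :
    Reach A (Fin.append p p) (Fin.append u w) := by
  have hback := (hG.pi A).reach_symm hvw
  obtain ⟨u', hu'⟩ := hback.exists_carry fun a => (a.1 ∘ Fin.castAdd n) +ᵥ u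
  have hsplit (a : A) : Fin.append (a.1 ∘ Fin.castAdd n) (a.1 ∘ Fin.natAdd n) ∈ A := by
    simpa only [Fin.append_castAdd_natAdd, Function.comp_def] using a.2
  have huv' : Reach A (Fin.append u v) (Fin.append u' (Fin.append p p ∘ Fin.castAdd n)) :=
    reach_of_mem_closure_range (F := fun q => Fin.append q.1 (q.2 ∘ Fin.castAdd n)) hu'
      (by fun_prop) fun a => ⟨⟨_, hA _ _ (hsplit a)⟩, (append_vadd_append _ _ _ _).trans <|
        congrArg _ <| funext fun i => by simp [vadd_apply]⟩
  have huw' : Reach A (Fin.append u w) (Fin.append u' (Fin.append p p ∘ Fin.natAdd n)) :=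
    reach_of_mem_closure_range (F := fun q => Fin.append q.1 (q.2 ∘ Fin.natAdd n)) hu'
      (by fun_prop) fun a => ⟨⟨_, hsplit a⟩, (append_vadd_append _ _ _ _).trans <|
        congrArg _ <| funext fun i => by simp [-Fin.natAdd_eq_addNat, vadd_apply]⟩
  have hcomp : Fin.append p p ∘ Fin.castAdd n = Fin.append p p ∘ Fin.natAdd n := by
    funext i
    simp only [Function.comp_apply, Fin.append_left, Fin.append_right]
  rw [hcomp] at huv'
  exact (huv.trans huv').trans ((hG.pi A).reach_symm huw')

end CoordinateAction

section Configurations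

variable {G X I J : Type*} [AddGroup G] [AddAction G X] [TopologicalSpace X]

/-- The closure of the set of configurations `(aᵢ +ᵥ x)ᵢ` with `x : X` and exponents `a ∈ E`. For
the exponents of parallelograms and of parallelepipeds these are the dynamical parallelograms and
parallelepipeds. -/
def configurations (E : AddSubgroup (I → G)) : Set (I → X) :=
  closure (Set.range fun p : X × E => p.2 +ᵥ fun _ : I => p.1)

variable {E : AddSubgroup (I → G)} {F : AddSubgroup (J → G)} {u v : I → X}

theorem comp_mem_configurations (hu : u ∈ configurations E) (f : J → I)
    (hf : ∀ a ∈ E, a ∘ f ∈ F) : u ∘ f ∈ configurations F :=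
  map_mem_closure (f := (· ∘ f)) (by fun_prop) hu (by
    rintro _ ⟨⟨x, a⟩, rfl⟩
    exact ⟨(x, ⟨_, hf a a.2⟩), rfl⟩)

variable [ContinuousConstVAdd G X]

theorem Reach.mem_configurations (huv : Reach E u v) (hu : u ∈ configurations E) :
    v ∈ configurations E :=
  huv.mem_of_isClosed isClosed_closure fun a =>
    map_mem_closure (continuous_const_vadd a) hu (by
      rintro _ ⟨⟨x, b⟩, rfl⟩
      exact ⟨(x, a + b), add_vadd a b _⟩)

theorem mem_configurations_iff_reach [AddAction.IsMinimal G X]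
    (hE : ∀ g : G, (fun _ => g) ∈ E) (x : X) :
    u ∈ configurations E ↔ Reach E (fun _ => x) u := by
  refine ⟨fun hu => ?_, fun h => h.mem_configurations (subset_closure ⟨(x, 0), zero_vadd _ _⟩)⟩
  refine closure_minimal (Set.range_subset_iff.2 ?_) (isClosed_setOf_reach _) hu
  rintro ⟨x', a⟩
  have hconst : Reach E (fun _ : I => x) (fun _ => x') :=
    (reach_of_isMinimal (G := G) x x').map (F := fun y _ => y) (by fun_prop)
      fun g => ⟨⟨_, hE g⟩, rfl⟩
  exact hconst.vadd_right a

end Configurations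

section Exponents

/-- The faces containing the vertex `0` of the cube, as lists of vertices. -/
def cornerFace : Fin 3 → Fin 4 → Fin 7 :=
  ![![0, 1, 2, 3], ![0, 1, 4, 5], ![0, 2, 4, 6]]

variable (G : Type*) [AddCommGroup G]

/-- The exponents `(k, k + m, k + n, k + m + n)` of parallelograms. -/
def parallelogramExponents : AddSubgroup (Fin 4 → G) where
  carrier := {a | a 0 + a 3 = a 1 + a 2}
  zero_mem' := by simp
  add_mem' {a b} ha hb := by simp only [Set.mem_ofPred_eq, Pi.add_apply] at *; grind
  neg_mem' {a} ha := by simp only [Set.mem_ofPred_eq, Pi.neg_apply] at *; grind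

/-- The exponents `(0, m, n, m + n)` of parallelograms with a given base point. -/
def cornerExponents : AddSubgroup (Fin 4 → G) where
  carrier := {a | a 0 = 0 ∧ a 3 = a 1 + a 2}
  zero_mem' := by simp
  add_mem' {a b} ha hb := by simp only [Set.mem_ofPred_eq, Pi.add_apply] at *; grind
  neg_mem' {a} ha := by simp only [Set.mem_ofPred_eq, Pi.neg_apply] at *; grind

/-- The exponents of parallelepipeds: those whose restriction to each face is the exponent of a
parallelogram. -/
def parallelepipedExponents : AddSubgroup (Fin 8 → G) where
  carrier := {a | ∀ f, a ∘ face f ∈ parallelogramExponents G}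
  zero_mem' _ := zero_mem _
  add_mem' ha hb f := add_mem (ha f) (hb f)
  neg_mem' ha f := neg_mem (ha f)

/-- The exponents `(0, m, n, m + n, p, m + p, n + p)` of parallelepipeds with a given base point
and without their last vertex. -/
def puncturedExponents : AddSubgroup (Fin 7 → G) where
  carrier := {a | a 0 = 0 ∧ ∀ f, a ∘ cornerFace f ∈ parallelogramExponents G}
  zero_mem' := ⟨rfl, fun _ => zero_mem _⟩
  add_mem' ha hb := ⟨by simp [ha.1, hb.1], fun f => add_mem (ha.2 f) (hb.2 f)⟩
  neg_mem' ha := ⟨by simp [ha.1], fun f => neg_mem (ha.2 f)⟩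

variable {G} {a : Fin 4 → G} {c : Fin 8 → G}

theorem mem_parallelogramExponents : a ∈ parallelogramExponents G ↔ a 0 + a 3 = a 1 + a 2 :=
  Iff.rfl

theorem mem_cornerExponents : a ∈ cornerExponents G ↔ a 0 = 0 ∧ a 3 = a 1 + a 2 := Iff.rfl

theorem cornerExponents_le : cornerExponents G ≤ parallelogramExponents G := fun a ha => by
  rw [mem_cornerExponents] at ha
  rw [mem_parallelogramExponents]
  grind

theorem vec_mem_cornerExponents (m n : G) : ![0, m, n, m + n] ∈ cornerExponents G := ⟨rfl, rfl⟩

theorem mem_parallelepipedExponents : c ∈ parallelepipedExponents G ↔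
    c 0 + c 3 = c 1 + c 2 ∧ c 0 + c 5 = c 1 + c 4 ∧ c 0 + c 6 = c 2 + c 4 ∧
      c 1 + c 7 = c 3 + c 5 := by
  refine ⟨fun hc => ⟨hc 0, hc 2, hc 4, hc 5⟩, fun ⟨h₀, h₂, h₄, h₅⟩ f => ?_⟩
  have h₁ : c 4 + c 7 = c 5 + c 6 := by grind
  have h₃ : c 2 + c 7 = c 3 + c 6 := by grind
  fin_cases f
  exacts [h₀, h₁, h₂, h₃, h₄, h₅]

theorem mem_puncturedExponents {d : Fin 7 → G} : d ∈ puncturedExponents G ↔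
    d 0 = 0 ∧ d 3 = d 1 + d 2 ∧ d 5 = d 1 + d 4 ∧ d 6 = d 2 + d 4 := by
  refine and_congr_right fun h₀ => ?_
  simp only [Fin.forall_fin_succ, mem_parallelogramExponents]
  change (d 0 + d 3 = d 1 + d 2 ∧ d 0 + d 5 = d 1 + d 4 ∧ d 0 + d 6 = d 2 + d 4 ∧ _) ↔ _
  simp only [h₀, zero_add, IsEmpty.forall_iff, and_true]

theorem vec_mem_puncturedExponents (m n p : G) :
    ![0, m, n, m + n, p, m + p, n + p] ∈ puncturedExponents G :=
  mem_puncturedExponents.2 ⟨rfl, rfl, rfl, rfl⟩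

theorem const_mem_parallelogramExponents (g : G) : (fun _ => g) ∈ parallelogramExponents G := rfl

theorem const_mem_parallelepipedExponents (g : G) : (fun _ => g) ∈ parallelepipedExponents G :=
  fun _ => rfl

theorem append_self_mem_cornerExponents (a b : Fin 2 → G)
    (h : Fin.append a b ∈ cornerExponents G) : Fin.append a a ∈ cornerExponents G := by
  have h : a 0 = 0 ∧ b 1 = a 1 + b 0 := h
  change a 0 = 0 ∧ a 1 = a 1 + a 0
  grind

theorem append_self_mem_parallelogramExponents (a : Fin 2 → G) :
    Fin.append a a ∈ parallelogramExponents G := add_comm (a 0) (a 1)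

theorem append_self_mem_parallelepipedExponents (a b : Fin 4 → G)
    (h : Fin.append a b ∈ parallelepipedExponents G) :
    Fin.append a a ∈ parallelepipedExponents G := by
  have h : a 0 + a 3 = a 1 + a 2 := h 0
  exact mem_parallelepipedExponents.2
    ⟨h, add_comm (a 0) (a 1), add_comm (a 0) (a 2), add_comm (a 1) (a 3)⟩

theorem exists_face_of_hammingDist_eq_one : ∀ i j k l : Fin 8, i ≠ l → j ≠ k →
    hammingDist (vertex i) (vertex j) = 1 → hammingDist (vertex i) (vertex k) = 1 →
    hammingDist (vertex l) (vertex j) = 1 → hammingDist (vertex l) (vertex k) = 1 →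
    ∃ f, (s(i, l) = s(face f 0, face f 3) ∧ s(j, k) = s(face f 1, face f 2)) ∨
      (s(i, l) = s(face f 1, face f 2) ∧ s(j, k) = s(face f 0, face f 3)) := by
  decide +kernel

theorem IsEuclidean.comp_mem_parallelepipedExponents {σ : Equiv.Perm (Fin 8)} (hσ : IsEuclidean σ)
    (hc : c ∈ parallelepipedExponents G) : c ∘ σ ∈ parallelepipedExponents G := fun f => by
  have hsum {i j k l : Fin 8} (h : s(i, j) = s(k, l)) : c i + c j = c k + c l := by
    obtain ⟨rfl, rfl⟩ | ⟨rfl, rfl⟩ := Sym2.eq_iff.1 h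
    exacts [rfl, add_comm _ _]
  have hdiagonal : face f 0 ≠ face f 3 ∧ face f 1 ≠ face f 2 := by decide +revert
  have hedge : ∀ i ∈ ({0, 3} : Set (Fin 4)), ∀ j ∈ ({1, 2} : Set (Fin 4)),
      hammingDist (vertex (σ (face f i))) (vertex (σ (face f j))) = 1 := by
    intro i hi j hj
    rw [hσ]
    obtain rfl | rfl := hi <;> obtain rfl | rfl := hj <;> decide +revert
  obtain ⟨f', ⟨h, h'⟩ | ⟨h, h'⟩⟩ := exists_face_of_hammingDist_eq_one _ _ _ _
    (σ.injective.ne hdiagonal.1) (σ.injective.ne hdiagonal.2) (hedge 0 (by simp) 1 (by simp))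
    (hedge 0 (by simp) 2 (by simp)) (hedge 3 (by simp) 1 (by simp)) (hedge 3 (by simp) 2 (by simp))
  · exact (hsum h).trans ((hc f').trans (hsum h').symm)
  · exact (hsum h).trans ((hc f').symm.trans (hsum h').symm)

end Exponents

section Faces

variable {G X I : Type*} [AddCommGroup G] [AddAction G X]

theorem pair_eq_append (u v : Fin 4 → X) : pair u v = Fin.append u v := by
  ext i; fin_cases i <;> rfl

variable [TopologicalSpace X] {x x₁ x₂ x₃ x₄ x₅ x₆ x₇ : X}

theorem configurations_parallelogramExponents :
    configurations (parallelogramExponents G) = closure {y : Fin 4 → X | ∃ (x : X) (m n : G),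
      y = ![x, m +ᵥ x, n +ᵥ x, (m + n) +ᵥ x]} := by
  refine congrArg closure (Set.ext fun y => ⟨?_, ?_⟩)
  · rintro ⟨⟨x, a, ha⟩, rfl⟩
    rw [mem_parallelogramExponents] at ha
    have h₃ : a 1 - a 0 + (a 2 - a 0) + a 0 = a 3 := by grind
    refine ⟨a 0 +ᵥ x, a 1 - a 0, a 2 - a 0, ?_⟩
    ext i; fin_cases i <;> simp [vadd_apply, ← add_vadd, h₃]
  · rintro ⟨x, m, n, rfl⟩
    refine ⟨(x, ⟨_, cornerExponents_le (vec_mem_cornerExponents m n)⟩), ?_⟩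
    ext i; fin_cases i <;> simp [vadd_apply]

theorem configurations_parallelepipedExponents :
    configurations (parallelepipedExponents G) = closure {y : Fin 8 → X | ∃ (x : X) (m n p : G),
      y = ![x, m +ᵥ x, n +ᵥ x, (m + n) +ᵥ x,
        p +ᵥ x, (m + p) +ᵥ x, (n + p) +ᵥ x, (m + n + p) +ᵥ x]} := by
  refine congrArg closure (Set.ext fun y => ⟨?_, ?_⟩)
  · rintro ⟨⟨x, a, ha⟩, rfl⟩
    obtain ⟨h₀, h₂, h₄, h₅⟩ := mem_parallelepipedExponents.1 ha
    have h₃ : a 1 - a 0 + (a 2 - a 0) + a 0 = a 3 := by grind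
    have h₅' : a 1 - a 0 + (a 4 - a 0) + a 0 = a 5 := by grind
    have h₆ : a 2 - a 0 + (a 4 - a 0) + a 0 = a 6 := by grind
    have h₇ : a 1 - a 0 + (a 2 - a 0) + (a 4 - a 0) + a 0 = a 7 := by grind
    refine ⟨a 0 +ᵥ x, a 1 - a 0, a 2 - a 0, a 4 - a 0, ?_⟩
    ext i; fin_cases i <;> simp [vadd_apply, ← add_vadd, h₃, h₅', h₆, h₇]
  · rintro ⟨x, m, n, p, rfl⟩
    refine ⟨(x, ⟨![0, m, n, m + n, p, m + p, n + p, m + n + p],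
      mem_parallelepipedExponents.2 ⟨?_, ?_, ?_, ?_⟩⟩), ?_⟩
    · exact zero_add _
    · exact zero_add _
    · exact zero_add _
    · change m + (m + n + p) = m + n + (m + p)
      abel
    · ext i; fin_cases i <;> simp [vadd_apply]

theorem swap_mem_configurations {x₀ x₁ x₂ x₃ : X}
    (h : ![x₀, x₁, x₂, x₃] ∈ configurations (parallelogramExponents G)) :
    ![x₂, x₃, x₀, x₁] ∈ configurations (parallelogramExponents G) := by
  convert! comp_mem_configurations (F := parallelogramExponents G) h ![2, 3, 0, 1] fun a
    (ha : a 0 + a 3 = a 1 + a 2) => show a 2 + a 1 = a 3 + a 0 by grind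
  ext i; fin_cases i <;> rfl

theorem transpose_mem_configurations {x₀ x₁ x₂ x₃ : X}
    (h : ![x₀, x₁, x₂, x₃] ∈ configurations (parallelogramExponents G)) :
    ![x₀, x₂, x₁, x₃] ∈ configurations (parallelogramExponents G) := by
  convert! comp_mem_configurations (F := parallelogramExponents G) h ![0, 2, 1, 3] fun a
    (ha : a 0 + a 3 = a 1 + a 2) => show a 0 + a 3 = a 2 + a 1 by grind
  ext i; fin_cases i <;> rfl

theorem pair_self_mem_configurations {u : Fin 4 → X}
    (hu : u ∈ configurations (parallelogramExponents G)) :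
    pair u u ∈ configurations (parallelepipedExponents G) := by
  convert! comp_mem_configurations hu ![0, 1, 2, 3, 0, 1, 2, 3] fun a ha =>
    mem_parallelepipedExponents.2 ⟨ha, add_comm _ _, add_comm _ _, add_comm _ _⟩ using 1
  ext i; fin_cases i <;> rfl

theorem pair_swap_mem_configurations {u v : Fin 4 → X}
    (h : pair u v ∈ configurations (parallelepipedExponents G)) :
    pair v u ∈ configurations (parallelepipedExponents G) := by
  have hσ : IsEuclidean (Equiv.addRight 4) := by unfold IsEuclidean; decide
  convert! comp_mem_configurations h (Equiv.addRight 4) fun a =>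
    hσ.comp_mem_parallelepipedExponents
  ext i; fin_cases i <;> rfl

theorem faces_mem_configurations
    (h : ![x, x₁, x₂, x₃, x₄, x₅, x₆, x₇] ∈ configurations (parallelepipedExponents G)) :
    ![x, x₁, x₂, x₃] ∈ configurations (parallelogramExponents G) ∧
      ![x, x₁, x₄, x₅] ∈ configurations (parallelogramExponents G) ∧
      ![x, x₂, x₄, x₆] ∈ configurations (parallelogramExponents G) := by
  have hface (f : Fin 6) := comp_mem_configurations h (face f) fun a ha => ha f
  refine ⟨?_, ?_, ?_⟩
  · convert hface 0 using 1; ext i; fin_cases i <;> rfl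
  · convert hface 2 using 1; ext i; fin_cases i <;> rfl
  · convert hface 4 using 1; ext i; fin_cases i <;> rfl

theorem mem_configurations_of_tendsto {m n : ℕ → G}
    (h₁ : Tendsto (fun i => m i +ᵥ x) atTop (𝓝 x₁))
    (h₂ : Tendsto (fun i => n i +ᵥ x) atTop (𝓝 x₂))
    (h₃ : Tendsto (fun i => (m i + n i) +ᵥ x) atTop (𝓝 x₃)) :
    ![x, x₁, x₂, x₃] ∈ configurations (parallelogramExponents G) := by
  refine mem_closure_of_tendsto (f := fun i => ![x, m i +ᵥ x, n i +ᵥ x, (m i + n i) +ᵥ x])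
    (b := atTop) (tendsto_pi_nhds.2 fun i => ?_) (Eventually.of_forall fun i =>
      ⟨(x, ⟨_, cornerExponents_le (vec_mem_cornerExponents (m i) (n i))⟩), ?_⟩)
  · fin_cases i
    exacts [tendsto_const_nhds, h₁, h₂, h₃]
  · ext j; fin_cases j <;> simp [vadd_apply]

variable [ContinuousConstVAdd G X]

theorem Reach.vec_mem_configurations {A : AddSubgroup (I → G)} {u v : I → X} (h : Reach A u v)
    {f : Fin 4 → I} (hf : ∀ a ∈ A, a ∘ f ∈ parallelogramExponents G)
    (hu : ![u (f 0), u (f 1), u (f 2), u (f 3)] ∈ configurations (parallelogramExponents G)) :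
    ![v (f 0), v (f 1), v (f 2), v (f 3)] ∈ configurations (parallelogramExponents G) := by
  have hcomp (w : I → X) : w ∘ f = ![w (f 0), w (f 1), w (f 2), w (f 3)] := by
    ext i; fin_cases i <;> rfl
  rw [← hcomp] at hu ⊢
  exact (h.comp f hf).mem_configurations hu

end Faces

section Closing

variable {G X : Type*} [AddCommGroup G] [AddAction G X] [TopologicalSpace X]
  {x x₁ x₂ x₃ x₄ x₅ x₆ : X}

theorem exists_tendsto_of_reach_puncturedExponents [FirstCountableTopology X]
    (h : Reach (puncturedExponents G) (fun _ => x) ![x, x₁, x₂, x₃, x₄, x₅, x₆]) :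
    ∃ m n p : ℕ → G,
      Tendsto (fun i => m i +ᵥ x) atTop (𝓝 x₁) ∧ Tendsto (fun i => n i +ᵥ x) atTop (𝓝 x₂) ∧
      Tendsto (fun i => (m i + n i) +ᵥ x) atTop (𝓝 x₃) ∧
      Tendsto (fun i => p i +ᵥ x) atTop (𝓝 x₄) ∧
      Tendsto (fun i => (m i + p i) +ᵥ x) atTop (𝓝 x₅) ∧
      Tendsto (fun i => (n i + p i) +ᵥ x) atTop (𝓝 x₆) := by
  obtain ⟨u, hu, hlim⟩ := mem_closure_iff_seq_limit.1 h
  choose a ha using hu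
  obtain rfl : (fun i => a i +ᵥ fun _ => x) = u := funext ha
  have hcoord (j : Fin 7) := tendsto_pi_nhds.1 hlim j
  have hmem (i : ℕ) := mem_puncturedExponents.1 (a i).2
  refine ⟨fun i => (a i).1 1, fun i => (a i).1 2, fun i => (a i).1 4,
    hcoord 1, hcoord 2, ?_, hcoord 4, ?_, ?_⟩
  · simpa only [← (hmem _).2.1] using! hcoord 3
  · simpa only [← (hmem _).2.2.1] using! hcoord 5
  · simpa only [← (hmem _).2.2.2] using! hcoord 6

variable [CompactSpace X]

theorem exists_reach_parallelepipedExponents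
    (h : Reach (puncturedExponents G) (fun _ => x) ![x, x₁, x₂, x₃, x₄, x₅, x₆]) :
    ∃ x₇, Reach (parallelepipedExponents G) (fun _ => x) ![x, x₁, x₂, x₃, x₄, x₅, x₆, x₇] := by
  obtain ⟨x₇, hx₇⟩ := h.exists_carry fun a => (a.1 1 + a.1 2 + a.1 4) +ᵥ x
  refine ⟨x₇, reach_of_mem_closure_range (z := fun _ => x) hx₇ (F := fun p : X × (Fin 7 → X) =>
    ![p.2 0, p.2 1, p.2 2, p.2 3, p.2 4, p.2 5, p.2 6, p.1]) (by fun_prop) ?_⟩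
  rintro ⟨a, ha⟩
  obtain ⟨h₀, h₃, h₅, h₆⟩ := mem_puncturedExponents.1 ha
  refine ⟨⟨![a 0, a 1, a 2, a 3, a 4, a 5, a 6, a 1 + a 2 + a 4],
    mem_parallelepipedExponents.2 ?_⟩, ?_⟩
  · change a 0 + a 3 = a 1 + a 2 ∧ a 0 + a 5 = a 1 + a 4 ∧ a 0 + a 6 = a 2 + a 4 ∧
      a 1 + (a 1 + a 2 + a 4) = a 3 + a 5
    grind
  · ext i; fin_cases i <;> simp [vadd_apply]

variable [AddAction.IsMinimal G X]

variable (G) in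
theorem exists_reach_vertex₄_const (x x₄ x₅ x₆ : X) :
    ∃ y₅ y₆, Reach (puncturedExponents G) ![x, x, x, x, x₄, x₅, x₆]
      ![x, x, x, x, x, y₅, y₆] := by
  obtain ⟨⟨y₅, y₆⟩, hy⟩ := (reach_of_isMinimal (G := G) x₄ x).exists_carry
    fun g => (g +ᵥ x₅, g +ᵥ x₆)
  refine ⟨y₅, y₆, reach_of_mem_closure_range (z := ![x, x, x, x, x₄, x₅, x₆]) hy
    (F := fun p : (X × X) × X => ![x, x, x, x, p.2, p.1.1, p.1.2]) (by fun_prop) fun g =>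
      ⟨⟨_, vec_mem_puncturedExponents 0 0 g⟩, ?_⟩⟩
  ext i; fin_cases i <;> simp [vadd_apply]

end Closing

section Corner

variable {G X : Type*} [AddCommGroup G] [AddAction G X] [TopologicalSpace X]

/-- The relation between the limits `a` and `b` of `m +ᵥ x` and `(m + n) +ᵥ x` when `n +ᵥ x`
returns to `x`. -/
def CornerRel (G : Type*) {X : Type*} [AddCommGroup G] [AddAction G X] [TopologicalSpace X]
    (x a b : X) : Prop :=
  Reach (cornerExponents G) (fun _ => x) ![x, a, x, b]

theorem isClosed_setOf_cornerRel (x : X) : IsClosed {p : X × X | CornerRel G x p.1 p.2} :=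
  (isClosed_setOf_reach _).preimage (f := fun p : X × X => ![x, p.1, x, p.2]) (by fun_prop)

theorem CornerRel.refl [AddAction.IsMinimal G X] (x a : X) : CornerRel G x a a :=
  reach_of_mem_closure_range (reach_of_isMinimal (G := G) x a) (F := fun y => ![x, y, x, y])
    (by fun_prop) fun g => ⟨⟨_, vec_mem_cornerExponents g 0⟩, by
      ext i; fin_cases i <;> simp [vadd_apply]⟩

variable [ContinuousConstVAdd G X]

theorem CornerRel.trans [CompactSpace X] [T2Space X] (hG : IsDistalAction G X) {x a b c : X}
    (hab : CornerRel G x a b) (hbc : CornerRel G x b c) : CornerRel G x a c := by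
  have htrans := hG.reach_append_trans append_self_mem_cornerExponents (p := fun _ => x)
    (u := ![x, a]) (v := ![x, b]) (w := ![x, c])
  rw [append_vec_two, append_vec_two, append_vec_two, append_const] at htrans
  exact htrans hab hbc

theorem CornerRel.of_reach {x a b a' b' : X} (h : CornerRel G x a b)
    (hr : Reach G (a, b) (a', b')) : CornerRel G x a' b' :=
  Reach.trans h <| (hr.map (H := cornerExponents G) (F := fun p => ![x, p.1, x, p.2])
    (by fun_prop) fun g => ⟨⟨_, vec_mem_cornerExponents g 0⟩, by
      ext i; fin_cases i <;> simp [vadd_apply]⟩ :)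

theorem CornerRel.of_reach_base [AddAction.IsMinimal G X] {x a b : X}
    (h : Reach G (x, a) (x, b)) : CornerRel G x a b :=
  Reach.trans (CornerRel.refl (G := G) x a) <| (h.map (H := cornerExponents G)
    (F := fun p => ![x, a, p.1, p.2]) (by fun_prop) fun g => ⟨⟨_, vec_mem_cornerExponents 0 g⟩, by
      ext i; fin_cases i <;> simp [vadd_apply]⟩ :)

theorem cornerRel_of_reach_of_reach [CompactSpace X] [T2Space X] [AddAction.IsMinimal G X]
    (hG : IsDistalAction G X) {x a v b b' : X} (h : Reach G (x, a) (v, b))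
    (h' : Reach G (x, a) (v, b')) : CornerRel G x b b' := by
  obtain ⟨⟨c, c'⟩, hc⟩ := (reach_of_isMinimal (G := G) v x).exists_prod (b, b')
  have hxc : Reach G (x, a) (x, c) := h.trans
    (hc.map (F := fun p => (p.2, p.1.1)) (by fun_prop) fun g => ⟨g, rfl⟩)
  have hxc' : Reach G (x, a) (x, c') := h'.trans
    (hc.map (F := fun p => (p.2, p.1.2)) (by fun_prop) fun g => ⟨g, rfl⟩)
  have hcc' : CornerRel G x c c' := .of_reach_base (((hG.prod hG).reach_symm hxc).trans hxc')
  exact hcc'.of_reach <| (hG.prod hG).reach_symm <|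
    hc.map (F := fun p => p.1) (by fun_prop) fun g => ⟨g, rfl⟩

end Corner

section Equicontinuity

variable {G X Z : Type*} [AddGroup G] [AddAction G X] [MetricSpace X] [CompactSpace X]
  [PseudoMetricSpace Z] {h : X → Z} {x : X} {ε : ℝ}

theorem exists_pos_forall_dist_vadd_lt (hh : Continuous h)
    (hx : ∀ a v b b', Reach G (x, a) (v, b) → Reach G (x, a) (v, b') → h b = h b')
    (a : X) (hε : 0 < ε) : ∃ δ > 0, ∀ g g' : G, dist (g +ᵥ x) (g' +ᵥ x) < δ →
      dist (h (g +ᵥ a)) (h (g' +ᵥ a)) < ε := by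
  let K : Set ((X × X) × (X × X)) :=
    {p | Reach G (x, a) p.1 ∧ Reach G (x, a) p.2 ∧ ε ≤ dist (h p.1.2) (h p.2.2)}
  have hfar : IsClosed {p : (X × X) × (X × X) | ε ≤ dist (h p.1.2) (h p.2.2)} :=
    isClosed_le continuous_const (by fun_prop)
  have hK : IsClosed K := ((isClosed_setOf_reach _).preimage continuous_fst).inter
    (((isClosed_setOf_reach _).preimage continuous_snd).inter hfar)
  obtain ⟨δ, hδ, hle⟩ := hK.isCompact.exists_forall_le' (f := fun p => dist p.1.1 p.2.1) (a := 0)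
    (by fun_prop) (by
      rintro ⟨⟨v, b⟩, v', b'⟩ ⟨hb, hb', hdist : ε ≤ dist (h b) (h b')⟩
      refine dist_pos.2 fun hv : v = v' => ?_
      subst hv
      rw [hx a v b b' hb hb', dist_self] at hdist
      exact hdist.not_gt hε)
  refine ⟨δ, hδ, fun g g' hlt => ?_⟩
  by_contra! hge
  exact (hle ((g +ᵥ x, g +ᵥ a), (g' +ᵥ x, g' +ᵥ a))
    ⟨reach_vadd g (x, a), reach_vadd g' (x, a), hge⟩).not_gt hlt

variable [ContinuousConstVAdd G X]

theorem exists_isOpen_forall_dist_vadd_le (hh : Continuous h)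
    (hx : ∀ a v b b', Reach G (x, a) (v, b) → Reach G (x, a) (v, b') → h b = h b')
    (hε : 0 < ε) : ∃ δ > 0, ∃ U : Set X, IsOpen U ∧ U.Nonempty ∧
      ∀ a ∈ U, ∀ g g' : G, dist (g +ᵥ x) (g' +ᵥ x) < δ →
        dist (h (g +ᵥ a)) (h (g' +ᵥ a)) ≤ ε := by
  let C (j : ℕ) : Set X := {a | ∀ g g' : G, dist (g +ᵥ x) (g' +ᵥ x) < 1 / ((j : ℝ) + 1) →
    dist (h (g +ᵥ a)) (h (g' +ᵥ a)) ≤ ε}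
  have hC (j : ℕ) : IsClosed (C j) := by
    simp only [C, Set.ofPred_forall]
    exact isClosed_iInter fun g => isClosed_iInter fun g' => isClosed_iInter fun _ =>
      isClosed_le (by fun_prop) continuous_const
  have hunion : ⋃ j, C j = Set.univ := Set.iUnion_eq_univ_iff.2 fun a => by
    obtain ⟨δ, hδ, hlt⟩ := exists_pos_forall_dist_vadd_lt hh hx a hε
    obtain ⟨j, hj⟩ := exists_nat_one_div_lt hδ
    exact ⟨j, fun g g' hgg' => (hlt g g' (hgg'.trans hj)).le⟩
  have : Nonempty X := ⟨x⟩
  obtain ⟨j, hj⟩ := nonempty_interior_of_iUnion_of_closed hC hunion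
  exact ⟨_, Nat.one_div_pos_of_nat, interior (C j), isOpen_interior, hj,
    fun a ha => interior_subset ha⟩

variable [AddAction.IsMinimal G X]

theorem exists_isOpen_forall_dist_lt (hh : Continuous h)
    (hx : ∀ a v b b', Reach G (x, a) (v, b) → Reach G (x, a) (v, b') → h b = h b')
    (hε : 0 < ε) : ∃ U : Set X, IsOpen U ∧ U.Nonempty ∧
      ∀ a ∈ U, ∀ b ∈ U, ∀ g : G, dist (h (g +ᵥ a)) (h (g +ᵥ b)) < ε := by
  obtain ⟨δ, hδ, U, hU, ⟨a₀, ha₀⟩, hUδ⟩ :=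
    exists_isOpen_forall_dist_vadd_le (G := G) hh hx (show 0 < ε / 5 by positivity)
  obtain ⟨s, hs⟩ := isCompact_univ.elim_finite_subcover
    (fun g : G => Metric.ball (g +ᵥ x) δ) (fun _ => Metric.isOpen_ball) fun y _ => by
      obtain ⟨_, ⟨g, rfl⟩, hg⟩ := Metric.mem_closure_iff.1 (reach_of_isMinimal (G := G) x y) δ hδ
      exact Set.mem_iUnion.2 ⟨g, hg⟩
  let V : Set X := U ∩ ⋂ g ∈ s, {a | dist (h (g +ᵥ a)) (h (g +ᵥ a₀)) < ε / 5}
  have hV : IsOpen V := hU.inter <| isOpen_biInter_finset fun g _ =>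
    isOpen_lt (by fun_prop) continuous_const
  refine ⟨V, hV, ⟨a₀, ha₀, Set.mem_iInter₂.2 fun g _ => ?_⟩, fun a ha b hb k => ?_⟩
  · rw [Set.mem_ofPred_eq, dist_self]
    positivity
  · obtain ⟨g, hgs, hg⟩ := Set.mem_iUnion₂.1 (hs (Set.mem_univ (k +ᵥ x)))
    have hnear (c : X) (hc : c ∈ V) : dist (h (k +ᵥ c)) (h (g +ᵥ a₀)) < 2 * (ε / 5) := by
      have hkg := hUδ c hc.1 k g hg
      have hgc : dist (h (g +ᵥ c)) (h (g +ᵥ a₀)) < ε / 5 := Set.mem_iInter₂.1 hc.2 g hgs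
      linarith [dist_triangle (h (k +ᵥ c)) (h (g +ᵥ c)) (h (g +ᵥ a₀))]
    linarith [hnear a ha, hnear b hb,
      dist_triangle_right (h (k +ᵥ a)) (h (k +ᵥ b)) (h (g +ᵥ a₀))]

/-- If the limit of `g +ᵥ x` determines that of `h (g +ᵥ a)`, for each `a`, it does so with a
modulus of continuity which, by Baire's theorem, is uniform on an open set of points `a`. -/
theorem equicontinuous_comp_vadd (hh : Continuous h)
    (hx : ∀ a v b b', Reach G (x, a) (v, b) → Reach G (x, a) (v, b') → h b = h b') :
    Equicontinuous fun (g : G) y => h (g +ᵥ y) := fun y =>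
  Metric.equicontinuousAt_iff_right.2 fun ε hε => by
    obtain ⟨U, hU, hne, hUε⟩ := exists_isOpen_forall_dist_lt (G := G) hh hx hε
    obtain ⟨k, hk⟩ := hU.exists_vadd_mem G y hne
    filter_upwards [(hU.preimage (continuous_const_vadd k)).mem_nhds hk] with z hz g
    simpa only [← add_vadd, sub_add_cancel] using hUε _ hk _ hz (g - k)

end Equicontinuity

section BasePoint

variable {G X : Type*} [AddCommGroup G] [AddAction G X] [MetricSpace X] [CompactSpace X]
  {x y z : X}

theorem apply_eq_of_mem_configurations {Z : Type*} [MetricSpace Z] {h : X → Z}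
    (hh : Continuous h) (hequi : Equicontinuous fun (g : G) y => h (g +ᵥ y))
    (hP : ![x, x, y, z] ∈ configurations (parallelogramExponents G)) : h y = h z := by
  refine eq_of_forall_dist_le fun ε hε => ?_
  obtain ⟨δ, hδ, hδε⟩ := Metric.uniformEquicontinuous_iff.1
    (CompactSpace.uniformEquicontinuous_of_equicontinuous hequi) ε hε
  have hfar : IsClosed {u : Fin 4 → X | δ ≤ dist (u 0) (u 1)} :=
    isClosed_le continuous_const (by fun_prop)
  have hnear : IsClosed {u : Fin 4 → X | dist (h (u 2)) (h (u 3)) ≤ ε} :=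
    isClosed_le (by fun_prop) continuous_const
  have hmem := closure_minimal (Set.range_subset_iff.2 ?_) (hfar.union hnear) hP
  · refine hmem.resolve_left fun hle : δ ≤ dist x x => ?_
    rw [dist_self] at hle
    exact hle.not_gt hδ
  · rintro ⟨x', a, ha⟩
    rw [mem_parallelogramExponents] at ha
    refine (le_or_gt δ (dist (a 0 +ᵥ x') (a 1 +ᵥ x'))).imp id fun hlt => ?_
    have hle := (hδε _ _ hlt (a 2 - a 0)).le
    rwa [← add_vadd, ← add_vadd, sub_add_cancel, show a 2 - a 0 + a 1 = a 3 by grind] at hle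

variable [ContinuousConstVAdd G X] [AddAction.IsMinimal G X]

/-- Otherwise a continuous function invariant under the relation of the corner would separate
`x` and `y`, although its translates are equicontinuous. -/
theorem cornerRel_of_mem_configurations (hG : IsDistalAction G X)
    (hP : ![x, x, x, y] ∈ configurations (parallelogramExponents G)) : CornerRel G x x y := by
  have : IsPreorder X (CornerRel G x) :=
    { refl := .refl x, trans := fun _ _ _ => .trans hG }
  suffices AntisymmRel.setoid X (CornerRel G x) x y from this.1
  by_contra hxy
  have hclosed : IsClosed {p : X × X | AntisymmRel.setoid X (CornerRel G x) p.1 p.2} :=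
    (isClosed_setOf_cornerRel x).inter ((isClosed_setOf_cornerRel x).preimage continuous_swap)
  obtain ⟨h, hinv, hne⟩ := exists_continuous_invariant_ne _ hclosed hxy
  refine hne (apply_eq_of_mem_configurations (map_continuous h)
    (equicontinuous_comp_vadd (x := x) (map_continuous h) fun a v b b' hb hb' => ?_) hP)
  exact hinv b b' ⟨cornerRel_of_reach_of_reach hG hb hb', cornerRel_of_reach_of_reach hG hb' hb⟩

theorem exists_reach_cornerExponents (u : Fin 4 → X) :
    ∃ y, Reach (cornerExponents G) u ![u 0, u 0, u 0, y] := by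
  obtain ⟨v, hv⟩ := (reach_of_isMinimal (G := G) (u 1) (u 0)).exists_prod (u 3)
  have huv : Reach (cornerExponents G) u ![u 0, u 0, u 2, v] :=
    reach_of_mem_closure_range hv (F := fun p => ![u 0, p.2, u 2, p.1]) (by fun_prop)
      fun g => ⟨⟨_, vec_mem_cornerExponents g 0⟩, by
        ext i; fin_cases i <;> simp [vadd_apply]⟩
  obtain ⟨w, hw⟩ := (reach_of_isMinimal (G := G) (u 2) (u 0)).exists_prod v
  have hvw : Reach (cornerExponents G) ![u 0, u 0, u 2, v] ![u 0, u 0, u 0, w] :=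
    reach_of_mem_closure_range hw (F := fun p => ![u 0, u 0, p.2, p.1]) (by fun_prop)
      fun g => ⟨⟨_, vec_mem_cornerExponents 0 g⟩, by
        ext i; fin_cases i <;> simp [vadd_apply]⟩
  exact ⟨w, huv.trans hvw⟩

theorem reach_cornerExponents_of_mem_configurations (hG : IsDistalAction G X) {u : Fin 4 → X}
    (hu : u ∈ configurations (parallelogramExponents G)) :
    Reach (cornerExponents G) (fun _ => u 0) u := by
  obtain ⟨y, huy⟩ := exists_reach_cornerExponents (G := G) u
  have hy : ![u 0, u 0, u 0, y] ∈ configurations (parallelogramExponents G) :=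
    Reach.mem_configurations (huy.comp id fun a ha => cornerExponents_le ha) hu
  exact Reach.trans (cornerRel_of_mem_configurations hG hy) ((hG.pi _).reach_symm huy)

end BasePoint

section Punctured

variable {G X : Type*} [AddCommGroup G] [AddAction G X] [MetricSpace X] [CompactSpace X]
  [ContinuousConstVAdd G X] [AddAction.IsMinimal G X] {x x₁ x₂ x₃ x₄ x₅ x₆ : X}

theorem reach_const_of_mem_configurations (hG : IsDistalAction G X)
    (h : ![x, x₁, x₂, x₃] ∈ configurations (parallelogramExponents G)) :
    Reach (cornerExponents G) ![x, x₁, x₂, x₃] fun _ => x :=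
  (hG.pi _).reach_symm (reach_cornerExponents_of_mem_configurations hG h)

theorem exists_reach_face₀₁₂₃_const (hG : IsDistalAction G X)
    (h : ![x, x₁, x₂, x₃] ∈ configurations (parallelogramExponents G)) (x₄ x₅ x₆ : X) :
    ∃ y₅ y₆, Reach (puncturedExponents G) ![x, x₁, x₂, x₃, x₄, x₅, x₆]
      ![x, x, x, x, x₄, y₅, y₆] := by
  obtain ⟨⟨y₅, y₆⟩, hy⟩ := (reach_const_of_mem_configurations hG h).exists_carry
    fun a => (a.1 1 +ᵥ x₅, a.1 2 +ᵥ x₆)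
  refine ⟨y₅, y₆, reach_of_mem_closure_range hy
    (F := fun p => ![p.2 0, p.2 1, p.2 2, p.2 3, x₄, p.1.1, p.1.2]) (by fun_prop) ?_⟩
  rintro ⟨a, ha⟩
  refine ⟨⟨![a 0, a 1, a 2, a 3, 0, a 1, a 2], mem_puncturedExponents.2
    ⟨ha.1, ha.2, (add_zero _).symm, (add_zero _).symm⟩⟩, ?_⟩
  ext i; fin_cases i <;> simp [vadd_apply]

theorem exists_reach_vertex₅_const (hG : IsDistalAction G X)
    (h : ![x, x, x, x₅] ∈ configurations (parallelogramExponents G)) (x₆ : X) :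
    ∃ y₆, Reach (puncturedExponents G) ![x, x, x, x, x, x₅, x₆] ![x, x, x, x, x, x, y₆] := by
  obtain ⟨y₆, hy⟩ := (reach_const_of_mem_configurations hG h).exists_carry fun a => a.1 2 +ᵥ x₆
  refine ⟨y₆, reach_of_mem_closure_range hy
    (F := fun p => ![p.2 0, p.2 1, p.2 0, p.2 1, p.2 2, p.2 3, p.1]) (by fun_prop) ?_⟩
  rintro ⟨a, h₀, h₃⟩
  refine ⟨⟨![a 0, a 1, a 0, a 1, a 2, a 3, a 2], mem_puncturedExponents.2
    ⟨h₀, by simp [h₀], h₃, by simp [h₀]⟩⟩, ?_⟩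
  ext i; fin_cases i <;> simp [vadd_apply]

theorem reach_vertex₆_const (hG : IsDistalAction G X)
    (h : ![x, x, x, x₆] ∈ configurations (parallelogramExponents G)) :
    Reach (puncturedExponents G) ![x, x, x, x, x, x, x₆] fun _ => x := by
  have hcomp := (reach_const_of_mem_configurations hG h).comp (B := puncturedExponents G)
    ![0, 0, 1, 1, 2, 2, 3] fun a ⟨h₀, h₃⟩ => mem_puncturedExponents.2
      ⟨h₀, by simp [h₀], by simp [h₀], h₃⟩
  convert! hcomp using 1
  ext i; fin_cases i <;> rfl

theorem reach_puncturedExponents (hG : IsDistalAction G X)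
    (h₁ : ![x, x₁, x₂, x₃] ∈ configurations (parallelogramExponents G))
    (h₂ : ![x, x₁, x₄, x₅] ∈ configurations (parallelogramExponents G))
    (h₃ : ![x, x₂, x₄, x₆] ∈ configurations (parallelogramExponents G)) :
    Reach (puncturedExponents G) (fun _ => x) ![x, x₁, x₂, x₃, x₄, x₅, x₆] := by
  have hface (f : Fin 3) (a : Fin 7 → G) (ha : a ∈ puncturedExponents G) :=
    ha.2 f
  obtain ⟨y₅, y₆, hy⟩ := exists_reach_face₀₁₂₃_const hG h₁ x₄ x₅ x₆
  obtain ⟨z₅, z₆, hz⟩ := exists_reach_vertex₄_const G x x₄ y₅ y₆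
  have hz₅ : ![x, x, x, z₅] ∈ configurations (parallelogramExponents G) :=
    (hy.trans hz).vec_mem_configurations (hface 1) h₂
  obtain ⟨w₆, hw⟩ := exists_reach_vertex₅_const hG hz₅ z₆
  have hw₆ : ![x, x, x, w₆] ∈ configurations (parallelogramExponents G) :=
    ((hy.trans hz).trans hw).vec_mem_configurations (hface 2) h₃
  exact (hG.pi _).reach_symm (((hy.trans hz).trans hw).trans (reach_vertex₆_const hG hw₆))

end Punctured

section Structure

variable {G X : Type*} [AddCommGroup G] [AddAction G X] [TopologicalSpace X]
  [ContinuousConstVAdd G X] [AddAction.IsMinimal G X]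

theorem self_mem_configurations (x₀ x₁ : X) :
    ![x₀, x₁, x₀, x₁] ∈ configurations (parallelogramExponents G) :=
  (mem_configurations_iff_reach const_mem_parallelogramExponents x₀).2 <|
    Reach.comp (CornerRel.refl (G := G) x₀ x₁) id fun _ ha => cornerExponents_le ha

variable [CompactSpace X]

theorem append_mem_configurations_trans [T2Space X] (hG : IsDistalAction G X) {n : ℕ}
    {E : AddSubgroup (Fin (n + n) → G)} (hconst : ∀ g : G, (fun _ => g) ∈ E)
    (hE : ∀ a b : Fin n → G, Fin.append a b ∈ E → Fin.append a a ∈ E) {u v w : Fin n → X}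
    (huv : Fin.append u v ∈ configurations E) (hvw : Fin.append v w ∈ configurations E) :
    Fin.append u w ∈ configurations E := by
  obtain ⟨_, ⟨x, _⟩, _⟩ := closure_nonempty_iff.1 ⟨_, huv⟩
  rw [mem_configurations_iff_reach hconst x, ← append_const n n x] at huv hvw ⊢
  exact hG.reach_append_trans hE huv hvw

theorem exists_mem_configurations (x₀ x₁ x₂ : X) :
    ∃ x₃, ![x₀, x₁, x₂, x₃] ∈ configurations (parallelogramExponents G) := by
  obtain ⟨x₃, hx₃⟩ := (reach_of_isMinimal (G := G) x₀ x₂).exists_carry fun g => g +ᵥ x₁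
  have hreach : Reach (parallelogramExponents G) ![x₀, x₁, x₀, x₁] ![x₀, x₁, x₂, x₃] :=
    reach_of_mem_closure_range hx₃ (F := fun p => ![x₀, x₁, p.2, p.1]) (by fun_prop) fun g =>
      ⟨⟨_, cornerExponents_le (vec_mem_cornerExponents 0 g)⟩, by
        ext i; fin_cases i <;> simp [vadd_apply]⟩
  exact ⟨x₃, hreach.mem_configurations (self_mem_configurations x₀ x₁)⟩

theorem isParallelogramStructure_configurations [T2Space X] (hG : IsDistalAction G X) :
    IsParallelogramStructure (configurations (parallelogramExponents G) : Set (Fin 4 → X)) where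
  equivalence :=
    { refl := fun a => self_mem_configurations a.1 a.2
      symm := swap_mem_configurations
      trans := fun {a b c} hab hbc => by
        rw [← append_vec_two] at hab hbc ⊢
        exact append_mem_configurations_trans (n := 2) hG const_mem_parallelogramExponents
          (fun a _ _ => append_self_mem_parallelogramExponents a) hab hbc }
  symmetry _ _ _ _ := transpose_mem_configurations
  closing := exists_mem_configurations

theorem pair_mem_configurations_trans [T2Space X] (hG : IsDistalAction G X) {u v w : Fin 4 → X}
    (huv : pair u v ∈ configurations (parallelepipedExponents G))
    (hvw : pair v w ∈ configurations (parallelepipedExponents G)) :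
    pair u w ∈ configurations (parallelepipedExponents G) := by
  rw [pair_eq_append] at huv hvw ⊢
  exact append_mem_configurations_trans (n := 4) hG const_mem_parallelepipedExponents
    append_self_mem_parallelepipedExponents huv hvw

end Structure

section Parallelepipeds

variable {G X : Type*} [AddCommGroup G] [AddAction G X] [MetricSpace X] [CompactSpace X]
  [ContinuousConstVAdd G X] [AddAction.IsMinimal G X]

theorem exists_mem_parallelepipeds (hG : IsDistalAction G X) {x₀ x₁ x₂ x₃ x₄ x₅ x₆ : X}
    (h₁ : ![x₀, x₁, x₂, x₃] ∈ configurations (parallelogramExponents G))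
    (h₂ : ![x₀, x₁, x₄, x₅] ∈ configurations (parallelogramExponents G))
    (h₃ : ![x₀, x₂, x₄, x₆] ∈ configurations (parallelogramExponents G)) :
    ∃ x₇, ![x₀, x₁, x₂, x₃, x₄, x₅, x₆, x₇] ∈ configurations (parallelepipedExponents G) := by
  obtain ⟨x₇, hx₇⟩ := exists_reach_parallelepipedExponents (reach_puncturedExponents hG h₁ h₂ h₃)
  exact ⟨x₇, (mem_configurations_iff_reach const_mem_parallelepipedExponents x₀).2 hx₇⟩

theorem isParallelepipedStructure_configurations (hG : IsDistalAction G X) :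
    IsParallelepipedStructure (configurations (parallelogramExponents G) : Set (Fin 4 → X))
      (configurations (parallelepipedExponents G)) where
  parallelogram := isParallelogramStructure_configurations hG
  face_mem _ hx f := comp_mem_configurations hx (face f) fun _ ha => ha f
  symmetry _ hx σ hσ := comp_mem_configurations hx σ fun _ => hσ.comp_mem_parallelepipedExponents
  equivalence :=
    { refl := fun u => pair_self_mem_configurations u.2
      symm := pair_swap_mem_configurations
      trans := pair_mem_configurations_trans hG }
  closing _ _ _ _ _ _ _ := exists_mem_parallelepipeds hG

end Parallelepipeds

section Homeomorph

variable {X : Type*} [TopologicalSpace X] (T : X ≃ₜ X)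

/-- The action of `ℤ` on `X` by the iterates of `T`. -/
abbrev zpowAction : AddAction ℤ X where
  vadd n x := (T ^ n) x
  zero_vadd _ := rfl
  add_vadd m n x := by
    change (T ^ (m + n)) x = (T ^ m) ((T ^ n) x)
    rw [zpow_add]
    rfl

theorem continuousConstVAdd_zpowAction :
    letI := zpowAction T; ContinuousConstVAdd ℤ X :=
  letI := zpowAction T
  ⟨fun n => (T ^ n).continuous⟩

theorem IsMinimal.isMinimal_zpowAction {T : X ≃ₜ X} (hT : IsMinimal T) :
    letI := zpowAction T; AddAction.IsMinimal ℤ X :=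
  letI := zpowAction T
  ⟨hT⟩

theorem IsDistal.isDistalAction_zpowAction {X : Type*} [MetricSpace X] {T : X ≃ₜ X}
    (hT : IsDistal T) : letI := zpowAction T; IsDistalAction ℤ X := by
  let := zpowAction T
  intro x y z h
  by_contra hxy
  have hbdd : BddBelow (Set.range fun n : ℤ => dist ((T ^ n) x) ((T ^ n) y)) :=
    ⟨0, by rintro _ ⟨n, rfl⟩; exact dist_nonneg⟩
  have hle := h.mem_of_isClosed (s := {p : X × X |
    ⨅ n : ℤ, dist ((T ^ n) x) ((T ^ n) y) ≤ dist p.1 p.2})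
    (isClosed_le continuous_const continuous_dist) fun n => ciInf_le hbdd n
  rw [Set.mem_ofPred_eq, dist_self] at hle
  exact hle.not_gt (hT x y hxy)

theorem parallelograms_eq_configurations :
    letI := zpowAction T; parallelograms T = configurations (parallelogramExponents ℤ) :=
  letI := zpowAction T
  configurations_parallelogramExponents.symm

theorem parallelepipeds_eq_configurations :
    letI := zpowAction T; parallelepipeds T = configurations (parallelepipedExponents ℤ) :=
  letI := zpowAction T
  configurations_parallelepipedExponents.symm

end Homeomorph

end DynPara

open DynPara in
theorem mainTheorem5_general {G X : Type*} [AddCommGroup G] [MetricSpace X] [CompactSpace X]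
    [AddAction G X] [ContinuousConstVAdd G X] [AddAction.IsMinimal G X] (hG : IsDistalAction G X) :
    IsClosed (configurations (X := X) (parallelogramExponents G)) ∧
    IsClosed (configurations (X := X) (parallelepipedExponents G)) ∧
    IsParallelepipedStructure (configurations (X := X) (parallelogramExponents G))
      (configurations (parallelepipedExponents G)) ∧
    (∀ u ∈ configurations (X := X) (parallelogramExponents G),
      ∀ v ∈ configurations (X := X) (parallelogramExponents G),
      ∀ w ∈ configurations (X := X) (parallelogramExponents G),
        pair u v ∈ configurations (parallelepipedExponents G) →
        pair v w ∈ configurations (parallelepipedExponents G) →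
        pair u w ∈ configurations (parallelepipedExponents G)) ∧
    ∀ x₀ x₁ x₂ x₃ x₄ x₅ x₆ : X,
      List.TFAE [
        ![x₀, x₁, x₂, x₃] ∈ configurations (parallelogramExponents G) ∧
          ![x₀, x₁, x₄, x₅] ∈ configurations (parallelogramExponents G) ∧
          ![x₀, x₂, x₄, x₆] ∈ configurations (parallelogramExponents G),
        ∃ x₇ : X, ![x₀, x₁, x₂, x₃, x₄, x₅, x₆, x₇] ∈ configurations (parallelepipedExponents G),
        ∃ m n p : ℕ → G,
          Tendsto (fun i => m i +ᵥ x₀) atTop (𝓝 x₁) ∧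
          Tendsto (fun i => n i +ᵥ x₀) atTop (𝓝 x₂) ∧
          Tendsto (fun i => (m i + n i) +ᵥ x₀) atTop (𝓝 x₃) ∧
          Tendsto (fun i => p i +ᵥ x₀) atTop (𝓝 x₄) ∧
          Tendsto (fun i => (m i + p i) +ᵥ x₀) atTop (𝓝 x₅) ∧
          Tendsto (fun i => (n i + p i) +ᵥ x₀) atTop (𝓝 x₆)] := by
  refine ⟨isClosed_closure, isClosed_closure, isParallelepipedStructure_configurations hG,
    fun _ _ _ _ _ _ => pair_mem_configurations_trans hG, fun x₀ x₁ x₂ x₃ x₄ x₅ x₆ => ?_⟩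
  tfae_have 1 → 2 := fun ⟨h₁, h₂, h₃⟩ => exists_mem_parallelepipeds hG h₁ h₂ h₃
  tfae_have 2 → 1 := fun ⟨_, h⟩ => faces_mem_configurations h
  tfae_have 1 → 3 := fun ⟨h₁, h₂, h₃⟩ =>
    exists_tendsto_of_reach_puncturedExponents (reach_puncturedExponents hG h₁ h₂ h₃)
  tfae_have 3 → 1 := fun ⟨_, _, _, h₁, h₂, h₃, h₄, h₅, h₆⟩ =>
    ⟨mem_configurations_of_tendsto h₁ h₂ h₃, mem_configurations_of_tendsto h₁ h₄ h₅,
      mem_configurations_of_tendsto h₂ h₄ h₆⟩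
  tfae_finish

theorem mainTheorem5 {X : Type*} [MetricSpace X] [CompactSpace X] [Nonempty X]
    (T : X ≃ₜ X) (hmin : DynPara.IsMinimal T) (hdist : DynPara.IsDistal T) :
    IsClosed (DynPara.parallelograms T) ∧ IsClosed (DynPara.parallelepipeds T) ∧
    DynPara.IsParallelepipedStructure (DynPara.parallelograms T) (DynPara.parallelepipeds T) ∧
    (∀ u ∈ DynPara.parallelograms T, ∀ v ∈ DynPara.parallelograms T,
      ∀ w ∈ DynPara.parallelograms T,
        DynPara.pair u v ∈ DynPara.parallelepipeds T →
        DynPara.pair v w ∈ DynPara.parallelepipeds T →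
        DynPara.pair u w ∈ DynPara.parallelepipeds T) ∧
    ∀ x₀ x₁ x₂ x₃ x₄ x₅ x₆ : X,
      List.TFAE [
        ![x₀, x₁, x₂, x₃] ∈ DynPara.parallelograms T ∧
          ![x₀, x₁, x₄, x₅] ∈ DynPara.parallelograms T ∧
          ![x₀, x₂, x₄, x₆] ∈ DynPara.parallelograms T,
        ∃ x₇ : X, ![x₀, x₁, x₂, x₃, x₄, x₅, x₆, x₇] ∈ DynPara.parallelepipeds T,
        ∃ m n p : ℕ → ℤ,
          Tendsto (fun i => (T ^ m i) x₀) atTop (𝓝 x₁) ∧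
          Tendsto (fun i => (T ^ n i) x₀) atTop (𝓝 x₂) ∧
          Tendsto (fun i => (T ^ (m i + n i)) x₀) atTop (𝓝 x₃) ∧
          Tendsto (fun i => (T ^ p i) x₀) atTop (𝓝 x₄) ∧
          Tendsto (fun i => (T ^ (m i + p i)) x₀) atTop (𝓝 x₅) ∧
          Tendsto (fun i => (T ^ (n i + p i)) x₀) atTop (𝓝 x₆)] := by
  let := DynPara.zpowAction T
  have := DynPara.continuousConstVAdd_zpowAction T
  have := hmin.isMinimal_zpowAction
  rw [DynPara.parallelograms_eq_configurations, DynPara.parallelepipeds_eq_configurations]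
  exact mainTheorem5_general hdist.isDistalAction_zpowAction
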